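/- **Conventions.** All spaces are Hausdorff. A semigroup $S$ is *inverse* if for every $x\in S$ there is a unique $y=x^{-1}\in S$ with $xyx=x$ and $yxy=y$. A *topological inverse semigroup* is an inverse semigroup with a Hausdorff topology in which multiplication and inversion are continuous. A *primitive inverse semigroup* is an inverse semigroup $S$ with zero $0$, $S\neq\{0\}$, in which every non-zero idempotent is minimal in the set of non-zero idempotents for the order $e\leqslant f\iff ef=fe=e$. A space is *pseudocompact* if each locally finite open cover of it is finite. For a subset $A$ of a semigroup with zero put $A^*=A\setminus\{0\}$. For a cardinal $\lambda\geqslant 1$ and a group $G$, the Brandt $\lambda$-extension $B_\lambda(G)$ is the set $(\lambda\times G\times\lambda)\sqcup\{0\}$ with $(\alpha,a,\beta)(\gamma,b,\delta)=(\alpha,ab,\delta)$ if $\beta=\gamma$, and with all other products equal to $0$. If $G$ is a topological group, a *topological Brandt $\lambda$-extension of $G$ in the category $\mathfrak{TISG}$ of topological inverse semigroups* is $B_\lambda(G)$ with a topology that makes it a topological inverse semigroup and such that for some $\alpha\in\lambda$ the map $g\mapsto(\alpha,g,\alpha)$ is a homeomorphism of $G$ onto the subspace $\{(\alpha,g,\alpha)\colon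 g\in G\}$. The *orthogonal sum* $\sum_{i\in\mathscr I}S_i$ of semigroups $S_i$ with zero is the disjoint union of the sets $S_i^*$ together with one common zero, where the product of two elements of the same $S_i$ is computed in $S_i$ and all other products are $0$; each $S_i$ is regarded as a subsemigroup of it. **Theorem 2.7.** Let $S$ be a primitive Hausdorff pseudocompact topological inverse semigroup. Then there are a set $\mathscr I$, finite cardinals $\lambda_i\geqslant 1$, pseudocompact Hausdorff topological groups $G_i$ and topological Brandt $\lambda_i$-extensions $B_{\lambda_i}(G_i)$ of $G_i$ in $\mathfrak{TISG}$ $(i\in\mathscr I)$ such that $S$ is topologically isomorphic to the orthogonal sum $\sum_{i\in\mathscr I}B_{\lambda_i}(G_i)$, equipped with a topology that makes it a topological inverse semigroup and that induces on each summand $B_{\lambda_i}(G_i)$ its given topology. Moreover, identifying $S$ with this orthogonal sum, the family $$\mathscr B(0)=\Big\{S\setminus\big(B_{\lambda_{i_1}}(G_{i_1})\cup\cdots\cup B_{\lambda_{i_n}}(G_{i_n})\big)^*\colon i_1,\ldots,i_n\in\mathscr I,\ n\in\mathbb N,\ n\geqslant 1\Big\}$$ is a base of the topology at the zero $0$ of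 $S$ (it consists of open neighbourhoods of $0$, and every open neighbourhood of $0$ contains a member of it). -/

import Mathlib

open Set Topology

universe u v

/-! ### Pseudocompactness and local bases -/

/-- A space is pseudocompact if each locally finite open cover of it is finite. -/
def IsPseudocompactSpace (X : Type u) [TopologicalSpace X] : Prop :=
  ∀ 𝒰 : Set (Set X), (∀ U ∈ 𝒰, IsOpen U) → ⋃₀ 𝒰 = univ →
    LocallyFinite (fun U : 𝒰 => (U : Set X)) → 𝒰.Finite

/-- A family of sets is a base of the topology at the point `x`: its members are open
neighbourhoods of `x`, and every open neighbourhood of `x` contains one of them. -/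
def IsBaseAt {X : Type u} [TopologicalSpace X] (x : X) (ℬ : Set (Set X)) : Prop :=
  (∀ U ∈ ℬ, IsOpen U ∧ x ∈ U) ∧ ∀ V : Set X, IsOpen V → x ∈ V → ∃ U ∈ ℬ, U ⊆ V

/-! ### Inverse semigroups -/

/-- Each `x` has a unique `y` with `x y x = x` and `y x y = y`. -/
def IsInverseSemigroup (S : Type u) [Semigroup S] : Prop :=
  ∀ x : S, ∃! y : S, x * y * x = x ∧ y * x * y = y

/-- The inversion of an inverse semigroup. -/
noncomputable def IsInverseSemigroup.inversion {S : Type u} [Semigroup S]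
    (h : IsInverseSemigroup S) : S → S :=
  fun x => (h x).choose

/-- A Hausdorff inverse semigroup with continuous operation and continuous inversion. -/
structure IsTopologicalInverseSemigroup (S : Type u) [Semigroup S] [TopologicalSpace S] :
    Prop where
  t2 : T2Space S
  continuous_mul : Continuous (fun p : S × S => p.1 * p.2)
  inverse : IsInverseSemigroup S
  continuous_inversion : Continuous inverse.inversion

/-- In a semigroup with zero, the idempotent `e` is a minimal element of the set of non-zero
idempotents for the natural order `f ≤ e ↔ f e = e f = f`. -/
def IsPrimitiveIdempotent {S : Type u} [SemigroupWithZero S] (e : S) : Prop :=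
  IsIdempotentElem e ∧ e ≠ 0 ∧
    ∀ f : S, IsIdempotentElem f → f ≠ 0 → f * e = f → e * f = f → f = e

/-- A non-trivial inverse semigroup (with zero) all of whose non-zero idempotents are
primitive. -/
structure IsPrimitiveInverseSemigroup (S : Type u) [SemigroupWithZero S] : Prop where
  nontrivial : Nontrivial S
  inverse : IsInverseSemigroup S
  primitive : ∀ e : S, IsIdempotentElem e → e ≠ 0 → IsPrimitiveIdempotent e

/-! ### Brandt extensions -/

/-- The underlying set `(Λ × G × Λ) ⊔ {0}` of the Brandt extension. -/
inductive BrandtExtension (Λ : Type v) (G : Type u) : Type (max u v)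
  | zero : BrandtExtension Λ G
  | elem (α : Λ) (g : G) (β : Λ) : BrandtExtension Λ G

namespace BrandtExtension

variable {Λ : Type v} {G : Type u}

open Classical in
/-- `(α, a, β) (γ, b, δ)` is `(α, a b, δ)` if `β = γ`; all other products are `0`. -/
noncomputable def mul [Mul G] : BrandtExtension Λ G → BrandtExtension Λ G → BrandtExtension Λ G
  | elem α a β, elem γ b δ => if β = γ then elem α (a * b) δ else zero
  | _, _ => zero

noncomputable instance [Semigroup G] : SemigroupWithZero (BrandtExtension Λ G) where
  mul := mul
  zero := zero
  zero_mul x := by cases x <;> rfl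
  mul_zero x := by cases x <;> rfl
  mul_assoc x y z := by
    change mul (mul x y) z = mul x (mul y z)
    cases x <;> cases y <;> cases z <;> simp only [mul] <;>
      split_ifs <;> simp_all [mul_assoc]

end BrandtExtension

/-- `(B_Λ(G), τB)` is a topological Brandt extension of the topological monoid `G` in the
category of topological inverse semigroups: `G` and `(B_Λ(G), τB)` are topological inverse
semigroups and, for some `α`, the natural map `g ↦ (α, g, α)` is a homeomorphism of `G` onto
the subspace `G_{α,α}`. -/
structure IsTopologicalBrandtExtension (Λ : Type v) (G : Type u) [Monoid G] [TopologicalSpace G]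
    [TopologicalSpace (BrandtExtension Λ G)] : Prop where
  base : IsTopologicalInverseSemigroup G
  ext : IsTopologicalInverseSemigroup (BrandtExtension Λ G)
  embedding : ∃ α : Λ, IsEmbedding (fun g : G => BrandtExtension.elem α g α)

/-! ### Orthogonal sums -/

/-- The underlying set of the orthogonal sum: the disjoint union of the sets `T i \ {0}`
together with a common zero. -/
inductive OrthogonalSum {I : Type v} (T : I → Type u) [∀ i, SemigroupWithZero (T i)] :
    Type (max u v)
  | zero : OrthogonalSum T
  | elem (i : I) (x : T i) (hx : x ≠ 0) : OrthogonalSum T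

namespace OrthogonalSum

variable {I : Type v} {T : I → Type u} [∀ i, SemigroupWithZero (T i)]

open Classical in
/-- The inclusion of a summand, identifying its zero with the common zero. -/
noncomputable def incl (i : I) (x : T i) : OrthogonalSum T :=
  if hx : x = 0 then zero else elem i x hx

open Classical in
/-- Products inside one summand are computed there; all other products are `0`. -/
noncomputable def mul : OrthogonalSum T → OrthogonalSum T → OrthogonalSum T
  | elem i x _, elem j y _ => if h : i = j then incl j ((h ▸ x : T j) * y) else zero
  | _, _ => zero

theorem mul_zero' (s : OrthogonalSum T) : mul s zero = zero := by cases s <;> rfl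

theorem zero_mul' (s : OrthogonalSum T) : mul zero s = zero := by cases s <;> rfl

theorem incl_zero (i : I) : incl i (0 : T i) = zero := by simp [incl]

theorem incl_of_ne (i : I) (x : T i) (hx : x ≠ 0) : incl i x = elem i x hx := by
  simp [incl, hx]

theorem incl_mul_incl (i : I) (x y : T i) : mul (incl i x) (incl i y) = incl i (x * y) := by
  by_cases hx : x = 0
  · subst hx; rw [zero_mul, incl_zero, zero_mul']
  by_cases hy : y = 0
  · subst hy; rw [mul_zero, incl_zero, mul_zero']
  rw [incl_of_ne i x hx, incl_of_ne i y hy]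
  simp [mul]

theorem incl_mul_incl_of_ne {i j : I} (h : i ≠ j) (x : T i) (y : T j) :
    mul (incl i x) (incl j y) = zero := by
  by_cases hx : x = 0
  · subst hx; rw [incl_zero, zero_mul']
  by_cases hy : y = 0
  · subst hy; rw [incl_zero, mul_zero']
  rw [incl_of_ne i x hx, incl_of_ne j y hy]
  simp [mul, h]

theorem eq_zero_or_incl (s : OrthogonalSum T) : s = zero ∨ ∃ i x, s = incl i x := by
  cases s with
  | zero => exact Or.inl rfl
  | elem i x hx => exact Or.inr ⟨i, x, (incl_of_ne i x hx).symm⟩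

noncomputable instance : SemigroupWithZero (OrthogonalSum T) where
  mul := mul
  zero := zero
  zero_mul := zero_mul'
  mul_zero := mul_zero'
  mul_assoc a b c := by
    change mul (mul a b) c = mul a (mul b c)
    rcases eq_zero_or_incl a with rfl | ⟨i, x, rfl⟩
    · simp only [zero_mul']
    rcases eq_zero_or_incl b with rfl | ⟨j, y, rfl⟩
    · simp only [zero_mul', mul_zero']
    rcases eq_zero_or_incl c with rfl | ⟨k, z, rfl⟩
    · simp only [mul_zero']
    by_cases hij : i = j
    · subst hij
      by_cases hjk : i = k
      · subst hjk; simp only [incl_mul_incl, mul_assoc]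
      · simp only [incl_mul_incl, incl_mul_incl_of_ne hjk, mul_zero']
    · rw [incl_mul_incl_of_ne hij, zero_mul']
      by_cases hjk : j = k
      · subst hjk; simp only [incl_mul_incl, incl_mul_incl_of_ne hij]
      · rw [incl_mul_incl_of_ne hjk, mul_zero']

/-- The summand `T i` as a subset of the orthogonal sum. -/
def summand (T : I → Type u) [∀ i, SemigroupWithZero (T i)] (i : I) : Set (OrthogonalSum T) :=
  range (incl i)

end OrthogonalSum

/-! A primitive inverse semigroup is a groupoid with a zero adjoined. A nonzero `x` is an arrow from
`x x⁻¹` to `x⁻¹ x`, and `x y ≠ 0` exactly when `x⁻¹ x = y y⁻¹ ≠ 0`: the product of two nonzero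
idempotents lies below both, so by minimality it vanishes unless they coincide. The connected
components give the orthogonal summands. Choosing a base idempotent `e` in a component and an arrow
from `e` to each of its idempotents identifies the component, with zero, with a Brandt extension of
the maximal subgroup at `e`.

The topology enters through one observation: for an idempotent `e ≠ 0`, `x x⁻¹ = e` means `e x ≠ 0`,
so the fibres of `x ↦ x x⁻¹` over nonzero idempotents are clopen, and likewise on the right. Open
sets taken from distinct fibres can therefore accumulate only at `0`; if they also avoid a
neighbourhood of `0`, they form a locally finite family, which pseudocompactness makes finite. This
gives finiteness of each component (`finite_rightIdem`) and shows that an open `V` containing `0`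
contains all but finitely many fibres (`finite_not_subset_nhds`). Deleting the components of the
exceptional fibres yields the base at `0`. Each maximal subgroup is clopen, hence pseudocompact. -/

/-- The nonzero idempotents of a semigroup with zero. -/
abbrev NonzeroIdempotent (S : Type u) [SemigroupWithZero S] : Type u :=
  {e : S // IsIdempotentElem e ∧ e ≠ 0}

/-! ### Inverse semigroups: idempotents, projections, maximal subgroups -/

namespace IsInverseSemigroup

section Basic

variable {S : Type u} [Semigroup S] (h : IsInverseSemigroup S)

include h

theorem mul_inversion_mul (x : S) : x * h.inversion x * x = x := (h x).choose_spec.1.1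

theorem inversion_mul_inversion (x : S) : h.inversion x * x * h.inversion x = h.inversion x :=
  (h x).choose_spec.1.2

theorem inversion_eq {x y : S} (h₁ : x * y * x = x) (h₂ : y * x * y = y) : h.inversion x = y :=
  ((h x).choose_spec.2 y ⟨h₁, h₂⟩).symm

theorem inversion_inversion (x : S) : h.inversion (h.inversion x) = x :=
  h.inversion_eq (h.inversion_mul_inversion x) (h.mul_inversion_mul x)

theorem inversion_of_isIdempotentElem {e : S} (he : IsIdempotentElem e) : h.inversion e = e :=
  h.inversion_eq (by rw [he.eq, he.eq]) (by rw [he.eq, he.eq])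

/-- If `x` is the inverse of `e f`, then `f x e` is another one, so `x = f x e` by uniqueness. This
makes `x` idempotent, hence its own inverse, and so `e f = x`. -/
theorem isIdempotentElem_mul {e f : S} (he : IsIdempotentElem e) (hf : IsIdempotentElem f) :
    IsIdempotentElem (e * f) := by
  have he' : ∀ z, e * (e * z) = e * z := fun z => by rw [← mul_assoc, he.eq]
  have hf' : ∀ z, f * (f * z) = f * z := fun z => by rw [← mul_assoc, hf.eq]
  set x := h.inversion (e * f) with hx
  have h₁ : e * (f * (x * (e * f))) = e * f := by
    simpa only [mul_assoc] using h.mul_inversion_mul (e * f)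
  have h₂ : x * (e * (f * x)) = x := by
    simpa only [mul_assoc] using h.inversion_mul_inversion (e * f)
  have h₂' : ∀ z, x * (e * (f * (x * z))) = x * z := fun z => by
    rw [← mul_assoc f, ← mul_assoc e, ← mul_assoc x, h₂]
  have hxf : x = f * (x * e) := by
    apply h.inversion_eq
    · simp only [mul_assoc, he', hf', h₁]
    · simp only [mul_assoc, he', hf', h₂']
  have hxx : IsIdempotentElem x := by
    change x * x = x
    calc x * x = (f * (x * e)) * (f * (x * e)) := by rw [← hxf]
      _ = x := by simp only [mul_assoc, h₂']; exact hxf.symm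
  have : e * f = x := by
    rw [← h.inversion_inversion (e * f), ← hx, h.inversion_of_isIdempotentElem hxx]
  rw [this]; exact hxx

/-- The idempotent `e f` is its own inverse, and `f e` is also an inverse of it. -/
theorem commute_of_isIdempotentElem {e f : S} (he : IsIdempotentElem e)
    (hf : IsIdempotentElem f) : e * f = f * e := by
  have he' : ∀ z, e * (e * z) = e * z := fun z => by rw [← mul_assoc, he.eq]
  have hf' : ∀ z, f * (f * z) = f * z := fun z => by rw [← mul_assoc, hf.eq]
  have hef := h.isIdempotentElem_mul he hf
  have hfe := h.isIdempotentElem_mul hf he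
  rw [← h.inversion_of_isIdempotentElem hef]
  apply h.inversion_eq
  · simpa only [mul_assoc, he', hf'] using hef.eq
  · simpa only [mul_assoc, he', hf'] using hfe.eq

end Basic

section Projections

variable {S : Type u} [Semigroup S] (h : IsInverseSemigroup S)

/-- The left idempotent `x x⁻¹` of `x`. -/
noncomputable def leftIdem (x : S) : S := x * h.inversion x

/-- The right idempotent `x⁻¹ x` of `x`. -/
noncomputable def rightIdem (x : S) : S := h.inversion x * x

theorem leftIdem_mul (x : S) : h.leftIdem x * x = x := h.mul_inversion_mul x

theorem mul_rightIdem (x : S) : x * h.rightIdem x = x := by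
  rw [rightIdem, ← mul_assoc]; exact h.mul_inversion_mul x

theorem leftIdem_inversion (x : S) : h.leftIdem (h.inversion x) = h.rightIdem x := by
  rw [leftIdem, h.inversion_inversion, rightIdem]

theorem rightIdem_inversion (x : S) : h.rightIdem (h.inversion x) = h.leftIdem x := by
  rw [rightIdem, h.inversion_inversion, leftIdem]

theorem isIdempotentElem_leftIdem (x : S) : IsIdempotentElem (h.leftIdem x) := by
  change h.leftIdem x * (x * h.inversion x) = _
  rw [← mul_assoc, h.leftIdem_mul, leftIdem]

theorem isIdempotentElem_rightIdem (x : S) : IsIdempotentElem (h.rightIdem x) := by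
  rw [← h.leftIdem_inversion]; exact h.isIdempotentElem_leftIdem _

theorem leftIdem_of_isIdempotentElem {e : S} (he : IsIdempotentElem e) : h.leftIdem e = e := by
  rw [leftIdem, h.inversion_of_isIdempotentElem he, he.eq]

theorem rightIdem_of_isIdempotentElem {e : S} (he : IsIdempotentElem e) : h.rightIdem e = e := by
  rw [rightIdem, h.inversion_of_isIdempotentElem he, he.eq]

/-- With matching idempotents this is inversion of a composite arrow in a groupoid: the inner
idempotents are absorbed by their neighbours. -/
theorem inversion_mul {x y : S} (hxy : h.rightIdem x = h.leftIdem y) :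
    h.inversion (x * y) = h.inversion y * h.inversion x := by
  have hx := h.mul_rightIdem x
  have hx' : h.rightIdem x * h.inversion x = h.inversion x := h.inversion_mul_inversion x
  have hy := h.leftIdem_mul y
  have hy' : h.inversion y * h.leftIdem y = h.inversion y := by
    rw [leftIdem, ← mul_assoc]; exact h.inversion_mul_inversion y
  apply h.inversion_eq
  · calc x * y * (h.inversion y * h.inversion x) * (x * y)
        = x * h.leftIdem y * h.rightIdem x * y := by simp only [leftIdem, rightIdem, mul_assoc]
      _ = x * y := by rw [← hxy, hx, hx]
  · calc h.inversion y * h.inversion x * (x * y) * (h.inversion y * h.inversion x)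
        = h.inversion y * h.rightIdem x * (h.leftIdem y * h.inversion x) := by
          simp only [leftIdem, rightIdem, mul_assoc]
      _ = h.inversion y * h.inversion x := by rw [hxy, hy', ← hxy, hx']

theorem leftIdem_mul_of_eq {x y : S} (hxy : h.rightIdem x = h.leftIdem y) :
    h.leftIdem (x * y) = h.leftIdem x := by
  rw [leftIdem, h.inversion_mul hxy]
  calc x * y * (h.inversion y * h.inversion x) = x * h.leftIdem y * h.inversion x := by
        simp only [leftIdem, mul_assoc]
    _ = h.leftIdem x := by rw [← hxy, h.mul_rightIdem, leftIdem]

theorem rightIdem_mul_of_eq {x y : S} (hxy : h.rightIdem x = h.leftIdem y) :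
    h.rightIdem (x * y) = h.rightIdem y := by
  rw [rightIdem, h.inversion_mul hxy]
  calc h.inversion y * h.inversion x * (x * y) = h.inversion y * (h.rightIdem x * y) := by
        simp only [rightIdem, mul_assoc]
    _ = h.rightIdem y := by rw [hxy, h.leftIdem_mul, rightIdem]

end Projections

section Zero

variable {S : Type u} [SemigroupWithZero S] (h : IsInverseSemigroup S)

theorem leftIdem_zero : h.leftIdem 0 = 0 := by rw [leftIdem, zero_mul]

theorem rightIdem_zero : h.rightIdem 0 = 0 := by rw [rightIdem, mul_zero]

theorem leftIdem_ne_zero {x : S} (hx : x ≠ 0) : h.leftIdem x ≠ 0 := fun h0 =>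
  hx (by rw [← h.leftIdem_mul x, h0, zero_mul])

theorem rightIdem_ne_zero {x : S} (hx : x ≠ 0) : h.rightIdem x ≠ 0 := fun h0 =>
  hx (by rw [← h.mul_rightIdem x, h0, mul_zero])

theorem ne_zero_of_leftIdem_ne_zero {x : S} (hx : h.leftIdem x ≠ 0) : x ≠ 0 := by
  rintro rfl; exact hx h.leftIdem_zero

/-- The maximal subgroup of an inverse semigroup at the nonzero idempotent `e`. -/
abbrev MaximalSubgroup (e : NonzeroIdempotent S) : Type u :=
  {x : S // h.leftIdem x = e.1 ∧ h.rightIdem x = e.1}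

theorem idempotent_mul_coe {e : NonzeroIdempotent S} (x : h.MaximalSubgroup e) :
    e.1 * x.1 = x.1 := (congrArg (· * x.1) x.2.1.symm).trans (h.leftIdem_mul _)

theorem coe_mul_idempotent {e : NonzeroIdempotent S} (x : h.MaximalSubgroup e) :
    x.1 * e.1 = x.1 := (congrArg (x.1 * ·) x.2.2.symm).trans (h.mul_rightIdem _)

noncomputable instance (e : NonzeroIdempotent S) : Group (h.MaximalSubgroup e) where
  mul x y := ⟨x.1 * y.1, by
    have hxy := x.2.2.trans y.2.1.symm
    exact ⟨(h.leftIdem_mul_of_eq hxy).trans x.2.1, (h.rightIdem_mul_of_eq hxy).trans y.2.2⟩⟩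
  one := ⟨e.1, h.leftIdem_of_isIdempotentElem e.2.1, h.rightIdem_of_isIdempotentElem e.2.1⟩
  inv x := ⟨h.inversion x.1,
    (h.leftIdem_inversion _).trans x.2.2, (h.rightIdem_inversion _).trans x.2.1⟩
  mul_assoc x y z := Subtype.ext (mul_assoc x.1 y.1 z.1)
  one_mul x := Subtype.ext (h.idempotent_mul_coe x)
  mul_one x := Subtype.ext (h.coe_mul_idempotent x)
  inv_mul_cancel x := Subtype.ext x.2.2

theorem inversion_zero : h.inversion 0 = 0 :=
  h.inversion_of_isIdempotentElem (mul_zero 0)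

end Zero

end IsInverseSemigroup

/-! ### Primitivity and the clopen fibres of the projections -/

namespace IsPrimitiveInverseSemigroup

variable {S : Type u} [SemigroupWithZero S] (hS : IsPrimitiveInverseSemigroup S)

include hS

/-- Idempotents commute, so `e f` is a nonzero idempotent below both `e` and `f`; minimality equates
it with each. -/
theorem eq_of_mul_ne_zero {e f : S} (he : IsIdempotentElem e) (hf : IsIdempotentElem f)
    (hef : e * f ≠ 0) : e = f := by
  have hc := hS.inverse.commute_of_isIdempotentElem he hf
  have hi := hS.inverse.isIdempotentElem_mul he hf
  have he0 : e ≠ 0 := by rintro rfl; exact hef (zero_mul _)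
  have hf0 : f ≠ 0 := by rintro rfl; exact hef (mul_zero _)
  have h₁ : e * f = e := (hS.primitive e he he0).2.2 _ hi hef
    (by rw [hc, mul_assoc, he.eq]) (by rw [← mul_assoc, he.eq])
  have h₂ : e * f = f := (hS.primitive f hf hf0).2.2 _ hi hef
    (by rw [mul_assoc, hf.eq]) (by rw [hc, ← mul_assoc, hf.eq])
  exact h₁.symm.trans h₂

/-- Inserting the projections gives `x y = x (x⁻¹ x) (y y⁻¹) y`, so the product of the two middle
idempotents is nonzero. -/
theorem rightIdem_eq_leftIdem_of_mul_ne_zero {x y : S} (hxy : x * y ≠ 0) :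
    hS.inverse.rightIdem x = hS.inverse.leftIdem y := by
  refine hS.eq_of_mul_ne_zero (hS.inverse.isIdempotentElem_rightIdem x)
    (hS.inverse.isIdempotentElem_leftIdem y) fun h0 => hxy ?_
  rw [← hS.inverse.mul_rightIdem x, ← hS.inverse.leftIdem_mul y, mul_assoc,
    ← mul_assoc (hS.inverse.rightIdem x), h0, zero_mul, mul_zero]

/-- This turns a fibre, closed by its definition, into the preimage of the open set of nonzero
elements under translation by `e`. -/
theorem leftIdem_eq_iff {e x : S} (he : IsIdempotentElem e) (he0 : e ≠ 0) :
    hS.inverse.leftIdem x = e ↔ e * x ≠ 0 := by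
  refine ⟨?_, fun hx => ?_⟩
  · rintro rfl
    rw [hS.inverse.leftIdem_mul]
    exact hS.inverse.ne_zero_of_leftIdem_ne_zero he0
  · rw [← hS.rightIdem_eq_leftIdem_of_mul_ne_zero hx, hS.inverse.rightIdem_of_isIdempotentElem he]

theorem rightIdem_eq_iff {e x : S} (he : IsIdempotentElem e) (he0 : e ≠ 0) :
    hS.inverse.rightIdem x = e ↔ x * e ≠ 0 := by
  refine ⟨?_, fun hx => ?_⟩
  · rintro rfl
    rw [hS.inverse.mul_rightIdem]
    rintro rfl
    exact he0 hS.inverse.rightIdem_zero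
  · rw [hS.rightIdem_eq_leftIdem_of_mul_ne_zero hx, hS.inverse.leftIdem_of_isIdempotentElem he]

section Topology

variable [TopologicalSpace S] (hT : IsTopologicalInverseSemigroup S)

include hT

omit hS in
theorem _root_.IsTopologicalInverseSemigroup.continuous_leftIdem :
    Continuous hT.inverse.leftIdem :=
  hT.continuous_mul.comp (continuous_id.prodMk hT.continuous_inversion)

omit hS in
theorem _root_.IsTopologicalInverseSemigroup.continuous_rightIdem :
    Continuous hT.inverse.rightIdem :=
  hT.continuous_mul.comp (hT.continuous_inversion.prodMk continuous_id)

theorem isOpen_leftIdem_eq {e : S} (he : IsIdempotentElem e) (he0 : e ≠ 0) :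
    IsOpen {x | hS.inverse.leftIdem x = e} := by
  have := hT.t2
  simp only [hS.leftIdem_eq_iff he he0]
  exact isOpen_ne.preimage (hT.continuous_mul.comp (continuous_const.prodMk continuous_id))

theorem isOpen_rightIdem_eq {e : S} (he : IsIdempotentElem e) (he0 : e ≠ 0) :
    IsOpen {x | hS.inverse.rightIdem x = e} := by
  have := hT.t2
  simp only [hS.rightIdem_eq_iff he he0]
  exact isOpen_ne.preimage (hT.continuous_mul.comp (continuous_id.prodMk continuous_const))

end Topology

end IsPrimitiveInverseSemigroup

/-! ### Pseudocompact spaces -/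

/-- Adjoining the whole space turns the family into a cover without spoiling local finiteness. That
bounds the set of values; each value is taken finitely often, since any of its points lies in only
finitely many members. -/
theorem IsPseudocompactSpace.finite_of_locallyFinite {X : Type u} [TopologicalSpace X]
    (hX : IsPseudocompactSpace X) {ι : Type v} {f : ι → Set X} (ho : ∀ i, IsOpen (f i))
    (hne : ∀ i, (f i).Nonempty) (hf : LocallyFinite f) : Finite ι := by
  have hg : LocallyFinite (fun o : Option ι => Option.elim' univ f o) := hf.option_elim' univ
  have hfin := hX (range fun o : Option ι => Option.elim' univ f o)
    (by rintro _ ⟨_ | i, rfl⟩; exacts [isOpen_univ, ho i])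
    (eq_univ_of_univ_subset (subset_sUnion_of_mem ⟨none, rfl⟩)) hg.on_range
  have hrange : (range f).Finite :=
    hfin.subset (by rintro _ ⟨i, rfl⟩; exact ⟨some i, rfl⟩)
  rw [← Set.finite_univ_iff]
  refine Set.Finite.of_finite_fibers f (by rwa [image_univ]) ?_
  rintro _ ⟨i, -, rfl⟩
  obtain ⟨x, hx⟩ := hne i
  refine (hf.point_finite x).subset ?_
  rintro j ⟨-, hj⟩
  change x ∈ f j
  rw [hj]; exact hx

/-- Open sets of `A` are open in `X`, and the open complement of `A` meets none of them, so local
finiteness passes to `X`. Only nonempty members are counted; the empty set adds at most one more. -/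
theorem IsPseudocompactSpace.of_isClopen {X : Type u} [TopologicalSpace X]
    (hX : IsPseudocompactSpace X) {A : Set X} (hA : IsClopen A) : IsPseudocompactSpace A := by
  intro 𝒰 ho _ hf
  have hne : Finite {U : 𝒰 // (U : Set A).Nonempty} := by
    refine hX.finite_of_locallyFinite
      (f := fun U : {U : 𝒰 // (U : Set A).Nonempty} => Subtype.val '' ((U : 𝒰) : Set A))
      (fun U => hA.isOpen.isOpenMap_subtype_val _ (ho _ U.1.2)) (fun U => U.2.image _) ?_
    intro x
    by_cases hx : x ∈ A
    · obtain ⟨t, ht, htf⟩ := hf ⟨x, hx⟩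
      refine ⟨Subtype.val '' t, hA.isOpen.isOpenMap_subtype_val.image_mem_nhds ht, ?_⟩
      refine (htf.preimage Subtype.val_injective.injOn).subset ?_
      rintro U ⟨_, ⟨y, hy, rfl⟩, ⟨z, hz, hzy⟩⟩
      exact ⟨y, hy, Subtype.val_injective hzy ▸ hz⟩
    · refine ⟨Aᶜ, hA.compl.isOpen.mem_nhds hx, ?_⟩
      convert Set.finite_empty
      rw [Set.eq_empty_iff_forall_notMem]
      rintro U ⟨_, ⟨y, hy, rfl⟩, hn⟩
      exact hn y.2
  have hsub : 𝒰 ⊆ insert ∅ (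
      range fun U : {U : 𝒰 // (U : Set A).Nonempty} => ((U : 𝒰) : Set A)) := by
    intro U hU
    rcases U.eq_empty_or_nonempty with h | h
    · exact Or.inl h
    · exact Or.inr ⟨⟨⟨U, hU⟩, h⟩, rfl⟩
  exact ((Set.finite_range _).insert _).subset hsub

/-! ### Finiteness in pseudocompact primitive inverse semigroups -/

/-- Away from `z`, the open fibre of `c` through a point meets at most one member; at `z`, the
neighbourhood `N` meets none. -/
theorem locallyFinite_of_subset_fibers {X : Type u} {Y : Type v} [TopologicalSpace X] {z : X}
    {c : X → Y} (hc : ∀ x ≠ z, IsOpen {y | c y = c x}) {ι : Type*} {f : ι → Set X} {k : ι → Y}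
    (hk : Function.Injective k) (hf : ∀ i, ∀ x ∈ f i, c x = k i) {N : Set X} (hN : N ∈ 𝓝 z)
    (hNf : ∀ i, ∀ x ∈ f i, x ∉ N) : LocallyFinite f := by
  intro x
  by_cases hx : x = z
  · subst hx
    refine ⟨N, hN, ?_⟩
    convert Set.finite_empty
    rw [Set.eq_empty_iff_forall_notMem]
    rintro i ⟨y, hy, hyN⟩
    exact hNf i y hy hyN
  · refine ⟨_, (hc x hx).mem_nhds rfl, Set.Subsingleton.finite ?_⟩
    rintro i ⟨y, hy, hyx⟩ j ⟨y', hy', hyx'⟩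
    exact hk (by rw [← hf i y hy, ← hf j y' hy']; exact hyx.trans hyx'.symm)

namespace IsPrimitiveInverseSemigroup

variable {S : Type u} [SemigroupWithZero S] (hS : IsPrimitiveInverseSemigroup S)
  [TopologicalSpace S] (hT : IsTopologicalInverseSemigroup S) (hpc : IsPseudocompactSpace S)

include hS hT

theorem isOpen_leftIdem_fiber {x : S} (hx : x ≠ 0) :
    IsOpen {y | hS.inverse.leftIdem y = hS.inverse.leftIdem x} :=
  hS.isOpen_leftIdem_eq hT (hS.inverse.isIdempotentElem_leftIdem x) (hS.inverse.leftIdem_ne_zero hx)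

theorem isOpen_rightIdem_fiber {x : S} (hx : x ≠ 0) :
    IsOpen {y | hS.inverse.rightIdem y = hS.inverse.rightIdem x} :=
  hS.isOpen_rightIdem_eq hT (hS.inverse.isIdempotentElem_rightIdem x)
    (hS.inverse.rightIdem_ne_zero hx)

theorem isClosed_leftIdem_eq (e : S) : IsClosed {x | hS.inverse.leftIdem x = e} :=
  have := hT.t2
  isClosed_singleton.preimage hT.continuous_leftIdem

theorem isClosed_rightIdem_eq (e : S) : IsClosed {x | hS.inverse.rightIdem x = e} :=
  have := hT.t2
  isClosed_singleton.preimage hT.continuous_rightIdem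

theorem isClopen_maximalSubgroup {e : S} (he : IsIdempotentElem e) (he0 : e ≠ 0) :
    IsClopen {x | hS.inverse.leftIdem x = e ∧ hS.inverse.rightIdem x = e} :=
  ⟨(hS.isClosed_leftIdem_eq hT e).inter (hS.isClosed_rightIdem_eq hT e),
    (hS.isOpen_leftIdem_eq hT he he0).inter (hS.isOpen_rightIdem_eq hT he he0)⟩

include hpc

/-- For fixed `e`, the arrows from `e` to the various `f` form nonempty open sets in distinct right
fibres. All of them avoid the complement of the closed left fibre over `e`, which is a neighbourhood
of `0`. -/
theorem finite_rightIdem {e : S} (he : IsIdempotentElem e) (he0 : e ≠ 0) :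
    {f | ∃ x, hS.inverse.leftIdem x = e ∧ hS.inverse.rightIdem x = f}.Finite := by
  set F := {f | ∃ x, hS.inverse.leftIdem x = e ∧ hS.inverse.rightIdem x = f} with hF
  have : Finite F := by
    refine hpc.finite_of_locallyFinite
      (f := fun f : F => {x | hS.inverse.leftIdem x = e} ∩ {x | hS.inverse.rightIdem x = f.1})
      ?_ ?_ ?_
    · rintro ⟨f, x, hx, rfl⟩
      refine (hS.isOpen_leftIdem_eq hT he he0).inter (hS.isOpen_rightIdem_fiber hT ?_)
      exact hS.inverse.ne_zero_of_leftIdem_ne_zero (hx ▸ he0)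
    · rintro ⟨f, x, hx, hf⟩
      exact ⟨x, hx, hf⟩
    · refine locallyFinite_of_subset_fibers (z := (0 : S)) (c := hS.inverse.rightIdem)
        (fun x hx => hS.isOpen_rightIdem_fiber hT hx) Subtype.val_injective
        (fun f x hx => hx.2) (N := {x | hS.inverse.leftIdem x = e}ᶜ)
        ((hS.isClosed_leftIdem_eq hT e).isOpen_compl.mem_nhds ?_) (fun f x hx hn => hn hx.1)
      intro h0
      exact he0 (h0.symm.trans hS.inverse.leftIdem_zero)
  exact Set.toFinite F

/-- Every neighbourhood of zero contains all but finitely many of the sets `{x | x x⁻¹ = e}`. -/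
theorem finite_not_subset_nhds {V : Set S} (hV : IsOpen V) (h0 : (0 : S) ∈ V) :
    {e : NonzeroIdempotent S | ¬ {x | hS.inverse.leftIdem x = e.1} ⊆ V}.Finite := by
  have h00 : (fun p : S × S => p.1 * p.2) ⁻¹' V ∈ 𝓝 ((0 : S), (0 : S)) :=
    (hV.preimage hT.continuous_mul).mem_nhds (by simpa using h0)
  obtain ⟨W₁, hW₁, W₂, hW₂, hWW⟩ := mem_nhds_prod_iff.1 h00
  obtain ⟨W, hWs, hW, h0W⟩ := mem_nhds_iff.1 (Filter.inter_mem hW₁ hW₂)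
  have hc : ∀ x : S, x ≠ 0 → IsOpen {y | hS.inverse.leftIdem y = hS.inverse.leftIdem x} :=
    fun x hx => hS.isOpen_leftIdem_fiber hT hx
  -- With `W W ⊆ V`, it suffices that `e ∈ W` and that the fibre over `e` lies in `closure W`. Each
  -- condition fails for finitely many `e`: the fibres over `A` avoid the preimage of `W` under the
  -- left projection, and the parts of fibres outside `closure W` avoid `W`.
  set A := {e : NonzeroIdempotent S | e.1 ∉ W} with hA
  set B := {e : NonzeroIdempotent S | ¬ {x | hS.inverse.leftIdem x = e.1} ⊆ closure W} with hB
  have hAfin : Finite A := by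
    refine hpc.finite_of_locallyFinite (f := fun e : A => {x | hS.inverse.leftIdem x = e.1.1})
      (fun e => hS.isOpen_leftIdem_eq hT e.1.2.1 e.1.2.2)
      (fun e => ⟨e.1.1, hS.inverse.leftIdem_of_isIdempotentElem e.1.2.1⟩) ?_
    refine locallyFinite_of_subset_fibers (z := (0 : S)) hc
      (Subtype.val_injective.comp Subtype.val_injective) (fun e x hx => hx)
      (N := hS.inverse.leftIdem ⁻¹' W)
      ((hW.preimage hT.continuous_leftIdem).mem_nhds ?_) ?_
    · change hS.inverse.leftIdem 0 ∈ W
      rwa [hS.inverse.leftIdem_zero]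
    · intro e x hx hn
      exact e.2 (hx ▸ hn)
  have hBfin : Finite B := by
    refine hpc.finite_of_locallyFinite
      (f := fun e : B => {x | hS.inverse.leftIdem x = e.1.1} ∩ (closure W)ᶜ)
      (fun e => (hS.isOpen_leftIdem_eq hT e.1.2.1 e.1.2.2).inter isClosed_closure.isOpen_compl)
      (fun e => not_subset.1 e.2) ?_
    exact locallyFinite_of_subset_fibers (z := (0 : S)) hc
      (Subtype.val_injective.comp Subtype.val_injective) (fun e x hx => hx.1)
      (N := W) (hW.mem_nhds h0W) (fun e x hx hn => hx.2 (subset_closure hn))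
  refine (A.toFinite.union B.toFinite).subset fun e he => ?_
  by_contra hn
  simp only [mem_union, not_or, hA, hB, mem_ofPred_eq, not_not] at hn
  refine he fun x hx => ?_
  have hx' : hS.inverse.leftIdem x = e.1 := hx
  have hx0 : x ≠ 0 := hS.inverse.ne_zero_of_leftIdem_ne_zero (hx' ▸ e.2.2)
  -- This open set contains `x`, because `x x⁻¹ = e ∈ W`, so it contains some `y ∈ W`. Then `x = (x
  -- y⁻¹) y` lies in `W W ⊆ V`.
  have hopen : IsOpen ({y | x * hS.inverse.inversion y ∈ W} ∩
      {y | hS.inverse.rightIdem y = hS.inverse.rightIdem x}) :=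
    (hW.preimage (hT.continuous_mul.comp
      (continuous_const.prodMk hT.continuous_inversion))).inter (hS.isOpen_rightIdem_fiber hT hx0)
  obtain ⟨y, ⟨hy₁, hy₂⟩, hyW⟩ := mem_closure_iff.1 (hn.2 hx) _ hopen
    ⟨by change hS.inverse.leftIdem x ∈ W; rw [hx']; exact hn.1, rfl⟩
  have hxy : x * hS.inverse.inversion y * y = x := by
    rw [mul_assoc]
    change x * hS.inverse.rightIdem y = x
    rw [show hS.inverse.rightIdem y = hS.inverse.rightIdem x from hy₂, hS.inverse.mul_rightIdem]
  rw [← hxy]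
  exact hWW (Set.mk_mem_prod (hWs hy₁).1 (hWs hyW).2)

end IsPrimitiveInverseSemigroup

/-! ### Subsemigroups and decompositions -/

/-- Closure of the image under inversion supplies inverses; their uniqueness and the continuity of
both operations pull back along the embedding. -/
theorem IsTopologicalInverseSemigroup.of_isEmbedding {S : Type u} {T : Type v} [Semigroup S]
    [TopologicalSpace S] [Semigroup T] [TopologicalSpace T] (hS : IsTopologicalInverseSemigroup S)
    {j : T → S} (hj : IsEmbedding j) (hmul : ∀ x y, j (x * y) = j x * j y)
    (hinv : ∀ x, ∃ y, j y = hS.inverse.inversion (j x)) : IsTopologicalInverseSemigroup T := by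
  have hex : IsInverseSemigroup T := by
    intro x
    obtain ⟨y, hy⟩ := hinv x
    refine ⟨y, ⟨hj.injective ?_, hj.injective ?_⟩, fun z hz => hj.injective ?_⟩
    · rw [hmul, hmul, hy, hS.inverse.mul_inversion_mul]
    · rw [hmul, hmul, hy, hS.inverse.inversion_mul_inversion]
    · rw [hy]
      exact (hS.inverse.inversion_eq (by rw [← hmul, ← hmul, hz.1])
        (by rw [← hmul, ← hmul, hz.2])).symm
  have hjinv : ∀ x, j (hex.inversion x) = hS.inverse.inversion (j x) := fun x =>
    (hS.inverse.inversion_eq (by rw [← hmul, ← hmul, hex.mul_inversion_mul])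
        (by rw [← hmul, ← hmul, hex.inversion_mul_inversion])).symm
  have := hS.t2
  refine ⟨hj.t2Space, ?_, hex, ?_⟩
  · rw [hj.continuous_iff]
    simp only [Function.comp_def, hmul]
    exact hS.continuous_mul.comp ((hj.continuous.comp continuous_fst).prodMk
      (hj.continuous.comp continuous_snd))
  · rw [hj.continuous_iff]
    simp only [Function.comp_def, hjinv]
    exact hS.continuous_inversion.comp hj.continuous

theorem IsInverseSemigroup.isTopologicalGroup_maximalSubgroup {S : Type u} [SemigroupWithZero S]
    [TopologicalSpace S] (h : IsInverseSemigroup S) (hS : IsTopologicalInverseSemigroup S)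
    (e : NonzeroIdempotent S) : IsTopologicalGroup (h.MaximalSubgroup e) where
  continuous_mul := continuous_induced_rng.2 (hS.continuous_mul.comp
    ((continuous_subtype_val.comp continuous_fst).prodMk
      (continuous_subtype_val.comp continuous_snd)))
  continuous_inv := continuous_induced_rng.2 (hS.continuous_inversion.comp continuous_subtype_val)

/-! ### Brandt coordinates on a connected component -/

namespace BrandtExtension

section ToSemigroup

variable {S : Type u} [SemigroupWithZero S] (h : IsInverseSemigroup S)
  {e : NonzeroIdempotent S} {Λ : Type v} (k : Λ → S)

theorem elem_mul_elem {G : Type u} [Semigroup G] (α β δ : Λ) (a b : G) :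
    elem α a β * elem β b δ = elem α (a * b) δ := by
  change mul _ _ = _
  simp [mul]

theorem elem_mul_elem_of_ne {G : Type u} [Semigroup G] {β γ : Λ} (hβ : β ≠ γ) (α δ : Λ)
    (a b : G) : elem α a β * elem γ b δ = (0 : BrandtExtension Λ G) := by
  change mul _ _ = zero
  simp [mul, hβ]

/-- The map from a Brandt extension of the maximal subgroup at `e` determined by a family `k` of
elements with left idempotent `e`. -/
noncomputable def toSemigroup : BrandtExtension Λ (h.MaximalSubgroup e) → S
  | zero => 0
  | elem α g β => h.inversion (k α) * g.1 * k β

theorem toSemigroup_zero : toSemigroup h k (0 : BrandtExtension Λ (h.MaximalSubgroup e)) = 0 := rfl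

variable {k} (hk : ∀ α, h.leftIdem (k α) = e.1)

include hk

theorem leftIdem_toSemigroup (α β : Λ) (g : h.MaximalSubgroup e) :
    h.leftIdem (toSemigroup h k (elem α g β)) = h.rightIdem (k α) := by
  have h₁ : h.rightIdem (h.inversion (k α)) = h.leftIdem g.1 := by
    rw [h.rightIdem_inversion, hk, g.2.1]
  change h.leftIdem (h.inversion (k α) * g.1 * k β) = _
  rw [h.leftIdem_mul_of_eq, h.leftIdem_mul_of_eq h₁, h.leftIdem_inversion]
  rw [h.rightIdem_mul_of_eq h₁, g.2.2, hk]

theorem rightIdem_toSemigroup (α β : Λ) (g : h.MaximalSubgroup e) :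
    h.rightIdem (toSemigroup h k (elem α g β)) = h.rightIdem (k β) := by
  have h₁ : h.rightIdem (h.inversion (k α)) = h.leftIdem g.1 := by
    rw [h.rightIdem_inversion, hk, g.2.1]
  change h.rightIdem (h.inversion (k α) * g.1 * k β) = _
  rw [h.rightIdem_mul_of_eq]
  rw [h.rightIdem_mul_of_eq h₁, g.2.2, hk]

/-- Recovers the group coordinate by continuous translations; nonvanishing, injectivity and the
embedding of the group all rest on it. -/
theorem mul_toSemigroup_mul (α β : Λ) (g : h.MaximalSubgroup e) :
    k α * toSemigroup h k (elem α g β) * h.inversion (k β) = g.1 := by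
  calc k α * toSemigroup h k (elem α g β) * h.inversion (k β)
      = h.leftIdem (k α) * g.1 * h.leftIdem (k β) := by
        simp only [toSemigroup, IsInverseSemigroup.leftIdem, mul_assoc]
    _ = g.1 := by
      rw [hk, hk, h.idempotent_mul_coe, h.coe_mul_idempotent]

theorem toSemigroup_elem_ne_zero (α β : Λ) (g : h.MaximalSubgroup e) :
    toSemigroup h k (elem α g β) ≠ 0 := by
  intro h0
  have hg := mul_toSemigroup_mul h hk α β g
  rw [h0, mul_zero, zero_mul] at hg
  have hg1 := g.2.1
  rw [← hg, h.leftIdem_zero] at hg1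
  exact e.2.2 hg1.symm

theorem toSemigroup_inversion (α β : Λ) (g : h.MaximalSubgroup e) :
    toSemigroup h k (elem β g⁻¹ α) = h.inversion (toSemigroup h k (elem α g β)) := by
  have h₁ : h.rightIdem (h.inversion (k α)) = h.leftIdem g.1 := by
    rw [h.rightIdem_inversion, hk, g.2.1]
  change _ = h.inversion (h.inversion (k α) * g.1 * k β)
  rw [h.inversion_mul, h.inversion_mul h₁, h.inversion_inversion, ← mul_assoc]
  · rfl
  · rw [h.rightIdem_mul_of_eq h₁, g.2.2, hk]

theorem exists_toSemigroup_eq {s : S} {α β : Λ} (hα : h.leftIdem s = h.rightIdem (k α))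
    (hβ : h.rightIdem s = h.rightIdem (k β)) :
    ∃ g : h.MaximalSubgroup e, toSemigroup h k (elem α g β) = s := by
  have h₁ : h.rightIdem s = h.leftIdem (h.inversion (k β)) := by rw [h.leftIdem_inversion, hβ]
  have h₂ : h.rightIdem (k α) = h.leftIdem (s * h.inversion (k β)) := by
    rw [h.leftIdem_mul_of_eq h₁, hα]
  -- The arrow `s` is transported to a loop at `e` along the chosen arrows `k α` and `k β`.
  refine ⟨⟨k α * (s * h.inversion (k β)), ?_, ?_⟩, ?_⟩
  · rw [h.leftIdem_mul_of_eq h₂, hk]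
  · rw [h.rightIdem_mul_of_eq h₂, h.rightIdem_mul_of_eq h₁, h.rightIdem_inversion, hk]
  · calc h.inversion (k α) * (k α * (s * h.inversion (k β))) * k β
        = h.rightIdem (k α) * s * h.rightIdem (k β) := by
          simp only [IsInverseSemigroup.rightIdem, mul_assoc]
      _ = s := by rw [← hα, h.leftIdem_mul, ← hβ, h.mul_rightIdem]

variable (hr : Function.Injective fun α => h.rightIdem (k α))

include hr

theorem injective_toSemigroup :
    Function.Injective (toSemigroup h k : BrandtExtension Λ (h.MaximalSubgroup e) → S) := by
  rintro (_ | ⟨α, g, β⟩) (_ | ⟨γ, g', δ⟩) hxy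
  · rfl
  · exact absurd hxy.symm (toSemigroup_elem_ne_zero h hk γ δ g')
  · exact absurd hxy (toSemigroup_elem_ne_zero h hk α β g)
  · obtain rfl : α = γ := hr (by
      simpa only [leftIdem_toSemigroup h hk] using congrArg h.leftIdem hxy)
    obtain rfl : β = δ := hr (by
      simpa only [rightIdem_toSemigroup h hk] using congrArg h.rightIdem hxy)
    congr 1
    apply Subtype.ext
    rw [← mul_toSemigroup_mul h hk α β g, ← mul_toSemigroup_mul h hk α β g', hxy]

end ToSemigroup

section Primitive

variable {S : Type u} [SemigroupWithZero S] (hS : IsPrimitiveInverseSemigroup S)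
  {e : NonzeroIdempotent S} {Λ : Type v} {k : Λ → S}

theorem toSemigroup_mul
    (hk : ∀ α, hS.inverse.leftIdem (k α) = e.1)
    (hr : Function.Injective fun α => hS.inverse.rightIdem (k α))
    (x y : BrandtExtension Λ (hS.inverse.MaximalSubgroup e)) :
    toSemigroup hS.inverse k (x * y) = toSemigroup hS.inverse k x * toSemigroup hS.inverse k y := by
  rcases x with _ | ⟨α, a, β⟩
  · exact (zero_mul _).symm
  rcases y with _ | ⟨γ, b, δ⟩
  · exact (mul_zero _).symm
  by_cases hβ : β = γ
  · subst hβ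
    rw [elem_mul_elem]
    change hS.inverse.inversion (k α) * (a.1 * b.1) * k δ = hS.inverse.inversion (k α) * a.1 * k β *
      (hS.inverse.inversion (k β) * b.1 * k δ)
    have hb : k β * (hS.inverse.inversion (k β) * (b.1 * k δ)) = b.1 * k δ := by
      rw [← mul_assoc]
      change hS.inverse.leftIdem (k β) * _ = _
      rw [hk, ← mul_assoc, hS.inverse.idempotent_mul_coe]
    simp only [mul_assoc, hb]
  · rw [elem_mul_elem_of_ne hβ, toSemigroup_zero]
    by_contra hne
    have := hS.rightIdem_eq_leftIdem_of_mul_ne_zero (Ne.symm hne)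
    rw [rightIdem_toSemigroup hS.inverse hk, leftIdem_toSemigroup hS.inverse hk] at this
    exact hβ (hr this)

theorem isTopologicalInverseSemigroup_induced [TopologicalSpace S]
    (hT : IsTopologicalInverseSemigroup S)
    (hk : ∀ α, hS.inverse.leftIdem (k α) = e.1)
    (hr : Function.Injective fun α => hS.inverse.rightIdem (k α))
    [TopologicalSpace (BrandtExtension Λ (hS.inverse.MaximalSubgroup e))]
    (hj : IsEmbedding
      (toSemigroup hS.inverse k : BrandtExtension Λ (hS.inverse.MaximalSubgroup e) → S)) :
    IsTopologicalInverseSemigroup (BrandtExtension Λ (hS.inverse.MaximalSubgroup e)) := by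
  refine hT.of_isEmbedding hj (toSemigroup_mul hS hk hr) ?_
  rintro (_ | ⟨α, g, β⟩)
  · exact ⟨zero, hS.inverse.inversion_zero.symm⟩
  · exact ⟨_, toSemigroup_inversion hS.inverse hk α β g⟩

theorem isTopologicalBrandtExtension [TopologicalSpace S] [Nonempty Λ]
    (hT : IsTopologicalInverseSemigroup S)
    (hk : ∀ α, hS.inverse.leftIdem (k α) = e.1)
    (hr : Function.Injective fun α => hS.inverse.rightIdem (k α))
    [TopologicalSpace (BrandtExtension Λ (hS.inverse.MaximalSubgroup e))]
    (hj : IsEmbedding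
      (toSemigroup hS.inverse k : BrandtExtension Λ (hS.inverse.MaximalSubgroup e) → S)) :
    IsTopologicalBrandtExtension Λ (hS.inverse.MaximalSubgroup e) where
  base := hT.of_isEmbedding .subtypeVal (fun _ _ => rfl) (fun x => ⟨x⁻¹, rfl⟩)
  ext := isTopologicalInverseSemigroup_induced hS hT hk hr hj
  embedding := by
    obtain ⟨α⟩ := ‹Nonempty Λ›
    refine ⟨α, ?_⟩
    have hmul : ∀ {f g : S → S}, Continuous f → Continuous g → Continuous fun x => f x * g x :=
      fun hf hg => hT.continuous_mul.comp (hf.prodMk hg)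
    rw [← hj.of_comp_iff]
    have hcont : Continuous fun x : S => hS.inverse.inversion (k α) * x * k α :=
      hmul (hmul continuous_const continuous_id) continuous_const
    have hcont' : Continuous fun x : S => k α * x * hS.inverse.inversion (k α) :=
      hmul (hmul continuous_const continuous_id) continuous_const
    -- Conjugating back by `k α` is continuous on `S` and turns the map into the subspace inclusion
    -- of the maximal subgroup.
    refine IsEmbedding.of_comp (hcont.comp continuous_subtype_val) hcont' ?_
    convert IsEmbedding.subtypeVal using 1
    funext g
    exact mul_toSemigroup_mul hS.inverse hk α α g

end Primitive

end BrandtExtension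

/-! ### Maps out of an orthogonal sum -/

namespace OrthogonalSum

variable {I : Type v} {T : I → Type u} [∀ i, SemigroupWithZero (T i)]
  {S : Type u} [SemigroupWithZero S] (j : ∀ i, T i → S)

/-- The map out of an orthogonal sum given by maps on the summands. -/
def toSemigroup : OrthogonalSum T → S
  | zero => 0
  | elem i x _ => j i x

variable {j} (h0 : ∀ i, j i 0 = 0)

include h0

theorem toSemigroup_incl (i : I) (x : T i) : toSemigroup j (incl i x) = j i x := by
  by_cases hx : x = 0
  · subst hx; rw [incl_zero, h0]; rfl
  · rw [incl_of_ne i x hx]; rfl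

theorem toSemigroup_mul (hmul : ∀ i x y, j i (x * y) = j i x * j i y)
    (hcross : ∀ i k, i ≠ k → ∀ x y, j i x * j k y = 0) (a b : OrthogonalSum T) :
    toSemigroup j (a * b) = toSemigroup j a * toSemigroup j b := by
  rcases eq_zero_or_incl a with rfl | ⟨i, x, rfl⟩
  · change toSemigroup j (mul zero b) = 0 * _
    rw [zero_mul', zero_mul]; rfl
  rcases eq_zero_or_incl b with rfl | ⟨k, y, rfl⟩
  · change toSemigroup j (mul _ zero) = _ * 0
    rw [mul_zero', mul_zero]; rfl
  change toSemigroup j (mul _ _) = _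
  rw [toSemigroup_incl h0, toSemigroup_incl h0]
  by_cases hik : i = k
  · subst hik; rw [incl_mul_incl, toSemigroup_incl h0, hmul]
  · rw [incl_mul_incl_of_ne hik, hcross i k hik]; rfl

theorem injective_toSemigroup (hinj : ∀ i, Function.Injective (j i))
    (hdisj : ∀ i k x y, x ≠ 0 → j i x = j k y → i = k) :
    Function.Injective (toSemigroup j) := by
  have hne : ∀ i (x : T i), x ≠ 0 → j i x ≠ 0 := fun i x hx h => hx (hinj i (h.trans (h0 i).symm))
  rintro (_ | ⟨i, x, hx⟩) (_ | ⟨k, y, hy⟩) hxy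
  · rfl
  · exact absurd hxy.symm (hne k y hy)
  · exact absurd hxy (hne i x hx)
  · obtain rfl := hdisj i k x y hx hxy
    obtain rfl := hinj i hxy
    rfl

theorem surjective_toSemigroup (hsurj : ∀ s, s ≠ 0 → ∃ i x, j i x = s) :
    Function.Surjective (toSemigroup j) := by
  intro s
  by_cases hs : s = 0
  · exact ⟨zero, hs.symm⟩
  · obtain ⟨i, x, rfl⟩ := hsurj s hs
    exact ⟨incl i x, toSemigroup_incl h0 i x⟩

end OrthogonalSum

/-! ### The decomposition and the base at zero -/

/-- Two nonzero idempotents are related if they are the left and right idempotents of a common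
element. -/
def IsInverseSemigroup.idempotentSetoid {S : Type u} [SemigroupWithZero S]
    (h : IsInverseSemigroup S) : Setoid (NonzeroIdempotent S) where
  r e f := ∃ x, h.leftIdem x = e.1 ∧ h.rightIdem x = f.1
  iseqv :=
    { refl e := ⟨e.1, h.leftIdem_of_isIdempotentElem e.2.1, h.rightIdem_of_isIdempotentElem e.2.1⟩
      symm := fun ⟨x, hx, hx'⟩ => ⟨h.inversion x, (h.leftIdem_inversion x).trans hx',
        (h.rightIdem_inversion x).trans hx⟩
      trans := fun ⟨x, hx, hx'⟩ ⟨y, hy, hy'⟩ => ⟨x * y,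
        (h.leftIdem_mul_of_eq (hx'.trans hy.symm)).trans hx,
        (h.rightIdem_mul_of_eq (hx'.trans hy.symm)).trans hy'⟩ }

theorem theorem2p7 {S : Type u} [SemigroupWithZero S] [TopologicalSpace S]
    (hprim : IsPrimitiveInverseSemigroup S)
    (htop : IsTopologicalInverseSemigroup S)
    (hpc : IsPseudocompactSpace S) :
    ∃ (I : Type u) (lam : I → ℕ) (G : I → Type u)
      (_ : ∀ i, Group (G i))
      (_ : ∀ i, TopologicalSpace (G i))
      (_ : ∀ i, TopologicalSpace (BrandtExtension (Fin (lam i)) (G i)))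
      (_ : TopologicalSpace (OrthogonalSum fun i => BrandtExtension (Fin (lam i)) (G i)))
      (φ : S ≃* OrthogonalSum fun i => BrandtExtension (Fin (lam i)) (G i)),
      (∀ i, 1 ≤ lam i) ∧
      (∀ i, IsTopologicalGroup (G i) ∧ T2Space (G i) ∧ IsPseudocompactSpace (G i)) ∧
      (∀ i, IsTopologicalBrandtExtension (Fin (lam i)) (G i)) ∧
      IsTopologicalInverseSemigroup
        (OrthogonalSum fun i => BrandtExtension (Fin (lam i)) (G i)) ∧
      (∀ i, IsEmbedding (OrthogonalSum.incl
        (T := fun i => BrandtExtension (Fin (lam i)) (G i)) i)) ∧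
      IsHomeomorph φ ∧
      IsBaseAt (0 : S) {U : Set S | ∃ F : Finset I, F.Nonempty ∧
        U = univ \ ((⋃ i ∈ F, φ ⁻¹' OrthogonalSum.summand
          (fun i => BrandtExtension (Fin (lam i)) (G i)) i) \ {0})} := by
  classical
  set h := hprim.inverse
  have := htop.t2
  let I := Quotient h.idempotentSetoid
  let cls : NonzeroIdempotent S → I := Quotient.mk _
  let rep : I → NonzeroIdempotent S := Quotient.out
  have hrep : ∀ i, cls (rep i) = i := Quotient.out_eq
  let D : I → Type u := fun i => {f : NonzeroIdempotent S // cls f = i}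
  have hconn : ∀ i (f : D i), ∃ x, h.leftIdem x = (rep i).1 ∧ h.rightIdem x = f.1.1 := fun i f =>
    Quotient.exact (s := h.idempotentSetoid) ((hrep i).trans f.2.symm)
  choose conn hconnl hconnr using hconn
  have hDfin : ∀ i, Finite (D i) := fun i => by
    rw [← Set.finite_univ_iff]
    refine Set.Finite.of_injOn (f := fun f : D i => f.1.1) ?_
      (fun f _ g _ hfg => Subtype.ext (Subtype.ext hfg))
      (hprim.finite_rightIdem htop hpc (rep i).2.1 (rep i).2.2)
    exact fun f _ => ⟨conn i f, hconnl i f, hconnr i f⟩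
  have hDne : ∀ i, Nonempty (D i) := fun i => ⟨⟨rep i, hrep i⟩⟩
  -- `Nat.card` is `0` on infinite types; finiteness from `hDfin` makes it the true size of the
  -- component.
  let lam : I → ℕ := fun i => Nat.card (D i)
  have hlam : ∀ i, 1 ≤ lam i := fun i => Nat.card_pos
  let enum : ∀ i, Fin (lam i) ≃ D i := fun i => (Finite.equivFin (D i)).symm
  let k : ∀ i, Fin (lam i) → S := fun i α => conn i (enum i α)
  have hk : ∀ i α, h.leftIdem (k i α) = (rep i).1 := fun i α => hconnl i _
  have hkr : ∀ i α, h.rightIdem (k i α) = (enum i α).1.1 := fun i α => hconnr i _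
  have hr : ∀ i, Function.Injective fun α => h.rightIdem (k i α) := fun i α β hαβ => by
    simp only [hkr] at hαβ
    exact (enum i).injective (Subtype.ext (Subtype.ext hαβ))
  let G : I → Type u := fun i => h.MaximalSubgroup (rep i)
  let B : I → Type u := fun i => BrandtExtension (Fin (lam i)) (G i)
  let j : ∀ i, B i → S := fun i => BrandtExtension.toSemigroup h (k i)
  have hj0 : ∀ i, j i 0 = 0 := fun i => rfl
  have hjinj : ∀ i, Function.Injective (j i) := fun i =>
    BrandtExtension.injective_toSemigroup h (hk i) (hr i)
  have hjcls : ∀ i (b : B i), b ≠ 0 → ∃ f : D i, h.leftIdem (j i b) = f.1.1 := by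
    rintro i (_ | ⟨α, g, β⟩) hb
    · exact absurd rfl hb
    · exact ⟨enum i α, (BrandtExtension.leftIdem_toSemigroup h (hk i) α β g).trans (hkr i α)⟩
  have hjclsr : ∀ i (b : B i), b ≠ 0 → ∃ f : D i, h.rightIdem (j i b) = f.1.1 := by
    rintro i (_ | ⟨α, g, β⟩) hb
    · exact absurd rfl hb
    · exact ⟨enum i β, (BrandtExtension.rightIdem_toSemigroup h (hk i) α β g).trans (hkr i β)⟩
  have hDeq : ∀ {i i'} (f : D i) (f' : D i'), f.1.1 = f'.1.1 → i = i' := fun f f' hff =>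
    f.2.symm.trans ((congrArg cls (Subtype.ext hff)).trans f'.2)
  have hjsurj : ∀ s (hs : h.leftIdem s ≠ 0),
      ∃ b, j (cls ⟨h.leftIdem s, h.isIdempotentElem_leftIdem s, hs⟩) b = s := by
    intro s hs
    have hs0 := h.ne_zero_of_leftIdem_ne_zero hs
    set e : NonzeroIdempotent S := ⟨h.leftIdem s, h.isIdempotentElem_leftIdem s, hs⟩ with he
    let f : NonzeroIdempotent S :=
      ⟨h.rightIdem s, h.isIdempotentElem_rightIdem s, h.rightIdem_ne_zero hs0⟩
    have hef : cls f = cls e := (Quotient.sound (s := h.idempotentSetoid) ⟨s, rfl, rfl⟩).symm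
    obtain ⟨g, hg⟩ := BrandtExtension.exists_toSemigroup_eq h (hk (cls e)) (s := s)
      (α := (enum (cls e)).symm ⟨e, rfl⟩) (β := (enum (cls e)).symm ⟨f, hef⟩)
      (by rw [hkr, Equiv.apply_symm_apply]) (by rw [hkr, Equiv.apply_symm_apply])
    exact ⟨_, hg⟩
  have hjmul : ∀ i x y, j i (x * y) = j i x * j i y := fun i =>
    BrandtExtension.toSemigroup_mul hprim (hk i) (hr i)
  have hcross : ∀ i i', i ≠ i' → ∀ x y, j i x * j i' y = 0 := by
    intro i i' hi x y
    by_contra hne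
    have hx : x ≠ 0 := by rintro rfl; exact hne (by rw [hj0, zero_mul])
    have hy : y ≠ 0 := by rintro rfl; exact hne (by rw [hj0, mul_zero])
    obtain ⟨f, hf⟩ := hjclsr i x hx
    obtain ⟨f', hf'⟩ := hjcls i' y hy
    exact hi (hDeq f f' (hf.symm.trans
      ((hprim.rightIdem_eq_leftIdem_of_mul_ne_zero hne).trans hf')))
  have hdisj : ∀ i i' x y, x ≠ 0 → j i x = j i' y → i = i' := by
    intro i i' x y hx hxy
    have hy : y ≠ 0 := by
      rintro rfl
      exact hx (hjinj i hxy)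
    obtain ⟨f, hf⟩ := hjcls i x hx
    obtain ⟨f', hf'⟩ := hjcls i' y hy
    exact hDeq f f' (by rw [← hf, hxy, hf'])
  let ψ : OrthogonalSum B → S := OrthogonalSum.toSemigroup j
  have hψinj : Function.Injective ψ := OrthogonalSum.injective_toSemigroup hj0 hjinj hdisj
  have hψsurj : Function.Surjective ψ := OrthogonalSum.surjective_toSemigroup hj0
    fun s hs => ⟨_, hjsurj s (h.leftIdem_ne_zero hs)⟩
  have hψmul : ∀ a b, ψ (a * b) = ψ a * ψ b := OrthogonalSum.toSemigroup_mul hj0 hjmul hcross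
  have hψincl : ∀ i b, ψ (OrthogonalSum.incl i b) = j i b := OrthogonalSum.toSemigroup_incl hj0
  let Ψ : OrthogonalSum B ≃* S := MulEquiv.ofBijective (⟨ψ, hψmul⟩ : OrthogonalSum B →ₙ* S)
    ⟨hψinj, hψsurj⟩
  have hΨ : ∀ a, Ψ a = ψ a := fun _ => rfl
  -- All topologies are pulled back from `S`, so their compatibility reduces to `ψ ∘ incl i = j i`.
  let _ : ∀ i, TopologicalSpace (B i) := fun i => .induced (j i) inferInstance
  let _ : TopologicalSpace (OrthogonalSum B) := .induced ψ inferInstance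
  have hjemb : ∀ i, IsEmbedding (j i) := fun i => ⟨⟨rfl⟩, hjinj i⟩
  have hψemb : IsEmbedding ψ := ⟨⟨rfl⟩, hψinj⟩
  have hmem : ∀ i (s : S) (hs : s ≠ 0), Ψ.symm s ∈ OrthogonalSum.summand B i ↔
      cls ⟨h.leftIdem s, h.isIdempotentElem_leftIdem s, h.leftIdem_ne_zero hs⟩ = i := by
    intro i s hs
    have hiff : Ψ.symm s ∈ OrthogonalSum.summand B i ↔ ∃ b, j i b = s :=
      exists_congr fun b => by rw [MulEquiv.eq_symm_apply, hΨ, hψincl]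
    rw [hiff]
    constructor
    · rintro ⟨b, rfl⟩
      obtain ⟨f, hf⟩ := hjcls i b (by rintro rfl; exact hs rfl)
      exact (congrArg cls (Subtype.ext hf)).trans f.2
    · rintro rfl
      exact hjsurj s (h.leftIdem_ne_zero hs)
  have hmem' : ∀ (F : Finset I) (s : S) (hs : s ≠ 0),
      s ∈ (⋃ i ∈ F, Ψ.symm ⁻¹' OrthogonalSum.summand B i) \ {0} ↔
      cls ⟨h.leftIdem s, h.isIdempotentElem_leftIdem s, h.leftIdem_ne_zero hs⟩ ∈ F := by
    intro F s hs
    simp only [mem_sdiff, mem_iUnion, mem_preimage, hmem _ s hs, mem_singleton_iff, hs,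
      not_false_eq_true, and_true, exists_prop, exists_eq_right']
  refine ⟨I, lam, G, inferInstance, inferInstance, inferInstance, inferInstance, Ψ.symm, hlam,
    fun i => ⟨h.isTopologicalGroup_maximalSubgroup htop _, inferInstance, hpc.of_isClopen
      (hprim.isClopen_maximalSubgroup htop (rep i).2.1 (rep i).2.2)⟩, fun i => ?_, ?_, fun i => ?_,
    ?_, ?_, ?_⟩
  · have : Nonempty (Fin (lam i)) := ⟨⟨0, hlam i⟩⟩
    exact BrandtExtension.isTopologicalBrandtExtension hprim htop (hk i) (hr i) (hjemb i)
  · exact htop.of_isEmbedding hψemb hψmul fun a => hψsurj _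
  · rw [← hψemb.of_comp_iff]
    convert hjemb i using 1
    funext b
    exact hψincl i b
  · exact (Ψ.toEquiv.toHomeomorphOfIsInducing hψemb.isInducing).symm.isHomeomorph
  · rintro _ ⟨F, -, rfl⟩
    refine ⟨?_, mem_univ _, fun h0 => h0.2 rfl⟩
    -- The deleted set is a finite union of closed left fibres: finitely many components, each with
    -- finitely many idempotents.
    have hclosed : IsClosed (⋃ i ∈ F, ⋃ f : D i, {x | h.leftIdem x = f.1.1}) :=
      F.finite_toSet.isClosed_biUnion fun i _ =>
        isClosed_iUnion_of_finite fun f => hprim.isClosed_leftIdem_eq htop _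
    convert hclosed.isOpen_compl using 1
    rw [compl_eq_univ_sdiff]
    congr 1
    ext s
    by_cases hs : s = 0
    · subst hs
      simp only [mem_sdiff, mem_singleton_iff, not_true_eq_false, and_false, mem_iUnion,
        mem_ofPred_eq, h.leftIdem_zero, false_iff, not_exists]
      exact fun i _ f hf => f.1.2.2 hf.symm
    · refine (hmem' F s hs).trans ?_
      simp only [mem_iUnion, mem_ofPred_eq]
      constructor
      · intro hF
        exact ⟨_, hF, ⟨_, rfl⟩, rfl⟩
      · rintro ⟨i, hi, f, hf⟩
        have : cls ⟨h.leftIdem s, h.isIdempotentElem_leftIdem s, h.leftIdem_ne_zero hs⟩ = i :=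
          (congrArg cls (Subtype.ext hf)).trans f.2
        rwa [this]
  · intro V hV h0V
    have hfin := hprim.finite_not_subset_nhds htop hpc hV h0V
    obtain ⟨s₀, hs₀⟩ := (have := hprim.nontrivial; exists_ne (0 : S))
    let i₀ : I := cls ⟨h.leftIdem s₀, h.isIdempotentElem_leftIdem s₀, h.leftIdem_ne_zero hs₀⟩
    -- The classes of the exceptional idempotents suffice; `i₀`, available because `S` is
    -- nontrivial, only keeps the index set nonempty.
    refine ⟨_, ⟨insert i₀ (hfin.toFinset.image cls), Finset.insert_nonempty _ _, rfl⟩, ?_⟩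
    rintro s ⟨-, hs⟩
    by_cases hs0 : s = 0
    · rwa [hs0]
    · rw [hmem' _ s hs0, Finset.mem_insert, not_or] at hs
      by_contra hsV
      exact hs.2 (Finset.mem_image_of_mem cls (hfin.mem_toFinset.2 fun hsub => hsV (hsub rfl)))
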